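/- Let $\vec k=(k_1,\dots,k_n)$ be a vector of nonnegative integers. A $\vec k$-Dyck path $D$ is a lattice path from height $0$ to height $0$, never below height $0$, whose up steps are, in this order, $S^{k_1},\dots,S^{k_n}$ (red arrows), where $S^{k_i}=(1,k_i)$, and whose other steps are down steps $W=(1,-1)$ (blue arrows). Let $r_i$ be the height at which the $i$-th red arrow starts and $p_i$ the number of blue arrows before it. Put $\mathrm{area}(D)=r_1+\dots+r_n$. The statistic $\mathrm{bounce}(D)$ is defined by the bounce path: set $x_0=0$; in stage $s=0,1,2,\dots$ the bounce path, standing in column $x_s$, goes north and reaches all red arrows with $p_i\le x_s$ that have not been reached before (let $v_s$ be their number), and then goes east by $h_s$ units to column $x_{s+1}=x_s+h_s$, where $h_s$ is the number of indices $i$ such that the $i$-th red arrow was reached in a stage $\ell_i$ with $\ell_i\le s<\ell_i+k_i$. Then $\mathrm{bounce}(D)=\sum_{s\ge0}s\,v_s=\sum_{i=1}^n\ell_i$. Define $$C_{\vec k}(q,t)=\sum_{D}q^{\mathrm{area}(D)}t^{\mathrm{bounce}(D)}\in\mathbb Z[q,t],$$ where $D$ runs over all $\vec k$-Dyck paths,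 and write $k^4=(k,k,k,k)$. Then, for every integer $k\ge0$, $C_{k^4}(q,t)=C_{k^4}(t,q)$. Moreover, in $\mathbb Z[q,t][[x]]$, $$\sum_{k\ge0}C_{k^4}(q,t)\,x^k=\frac{N}{(1-q^3tx)(1-q^2t^2x)(1-qt^3x)(1-q^6x)(1-t^6x)},$$ where $$\begin{aligned}N={}&1+(q^5t+q^4t^2+q^3t^3+q^2t^4+qt^5+q^4t+q^3t^2+q^2t^3+qt^4)x\\&+(q^6t^5+q^5t^6-q^7t^3-q^6t^4-q^5t^5-q^4t^6-q^3t^7-q^5t^4-q^4t^5)x^2\\&-(q^8t^8+q^9t^6+q^8t^7+q^7t^8+q^6t^9)x^3.\end{aligned}$$ -/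

import Mathlib

namespace QTCatalan

/-- A step of a lattice path: a red arrow `S^k`, i.e. the up step `(1, k)`, or a blue arrow `W`,
i.e. the down step `(1, -1)`. -/
inductive Step where
  | red (k : ℕ) : Step
  | blue : Step
  deriving DecidableEq

namespace Step

/-- The change of height along a step. -/
def rise : Step → ℤ
  | red k => k
  | blue => -1

/-- The length `k` of a red arrow `S^k`; `none` for a blue arrow. -/
def label? : Step → Option ℕ
  | red k => some k
  | blue => none

end Step

/-- The height (rank) of the end point of a path that starts at height `0`. -/
def height (D : List Step) : ℤ := (D.map Step.rise).sum

/-- The lengths of the red arrows of a path, from left to right. -/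
def redLabels (D : List Step) : List ℕ := D.filterMap Step.label?

/-- `D` is a `k`-Dyck path, `k = (k₁, …, kₙ)`: its red arrows are `S^{k₁}, …, S^{kₙ}` in this order,
it never goes below height `0`, and it ends at height `0`. -/
def IsDyckPath (k : List ℕ) (D : List Step) : Prop :=
  redLabels D = k ∧ (∀ P : List Step, P <+: D → 0 ≤ height P) ∧ height D = 0

/-- The starting heights of the red arrows of a path that starts at height `r`. -/
def redRanksFrom : ℤ → List Step → List ℤ
  | _, [] => []
  | r, Step.red k :: D => r :: redRanksFrom (r + k) D
  | r, Step.blue :: D => redRanksFrom (r - 1) D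

/-- The red ranks `(r₁ = 0, r₂, …, rₙ)` of a path: the starting heights of its red arrows. -/
def redRanks (D : List Step) : List ℤ := redRanksFrom 0 D

/-- The area of a path: the sum of its red ranks (which are nonnegative for a Dyck path). -/
def area (D : List Step) : ℕ := (redRanks D).sum.toNat

/-- The pairs `(p, k)`, one for every red arrow `S^k` of the path, where `p` is `w` plus the number of
blue arrows before that red arrow. -/
def redArrowsFrom : ℕ → List Step → List (ℕ × ℕ)
  | _, [] => []
  | w, Step.red k :: D => (w, k) :: redArrowsFrom w D
  | w, Step.blue :: D => redArrowsFrom (w + 1) D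

/-- Draw a path with a unit north step for every red arrow and a unit east step for every blue arrow.
This lists, for every red arrow `S^k`, the pair `(p, k)` where `p` is the column of its north step,
i.e. the number of blue arrows before it. -/
def redArrows (D : List Step) : List (ℕ × ℕ) := redArrowsFrom 0 D

/-- One stage of the construction of the bounce path. `A` lists the pairs (column, length) of the red
arrows, and `e` records for every red arrow the number of unit east steps it has contributed to the
bounce path so far, so that the bounce path stands in column `e.sum`. It first goes north until it is
blocked by the path; thereafter exactly the red arrows in columns `≤ e.sum` have been reached. Then it
goes east, where every red arrow `S^k` that has been reached contributes one unit step, unless it has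
already contributed `k` of them. Thus `S^k` contributes to the `k` consecutive east moves
that start with the stage in which it is reached. -/
def bounceStage (A : List (ℕ × ℕ)) (e : List ℕ) : List ℕ :=
  List.zipWith (fun a c => if a.1 ≤ e.sum then min a.2 (c + 1) else c) A e

/-- The column in which the bounce path of `D` stands at the beginning of stage `i`, `i = 0, 1, …`. -/
def bounceColumn (D : List Step) (i : ℕ) : ℕ :=
  ((bounceStage (redArrows D))^[i] (List.replicate (redArrows D).length 0)).sum

/-- The stage in which the bounce path of `D` reaches the red arrows in column `p`. (For a Dyck path
every red arrow is reached.) -/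
noncomputable def bounceLevel (D : List Step) (p : ℕ) : ℕ := sInf {i : ℕ | p ≤ bounceColumn D i}

/-- The bounce statistic `∑ i, i * vᵢ`, where `vᵢ` is the number of red arrows that the bounce path
reaches in stage `i`, i.e. the sum over all red arrows of the stage in which they are reached. -/
noncomputable def bounce (D : List Step) : ℕ := ((redArrows D).map fun a => bounceLevel D a.1).sum

theorem perm_steps (D : List Step) :
    D.Perm ((redLabels D).map Step.red ++ List.replicate (D.count Step.blue) Step.blue) := by
  induction D with
  | nil => simp [redLabels]
  | cons s D ih =>
    cases s with
    | red k => simpa [redLabels, Step.label?] using ih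
    | blue =>
      have h : redLabels (Step.blue :: D) = redLabels D := rfl
      rw [h, List.count_cons_self, List.replicate_succ]
      exact (ih.cons _).trans List.perm_middle.symm

theorem height_eq (D : List Step) :
    height D = ((redLabels D).sum : ℤ) - (D.count Step.blue : ℤ) := by
  induction D with
  | nil => simp [redLabels, height]
  | cons s D ih =>
    have h : height (s :: D) = s.rise + height D := by simp [height]
    cases s with
    | red k =>
      have h1 : redLabels (Step.red k :: D) = k :: redLabels D := rfl
      rw [h, ih, h1, List.count_cons_of_ne (by simp)]
      simp [Step.rise]
      ring
    | blue =>
      have h1 : redLabels (Step.blue :: D) = redLabels D := rfl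
      rw [h, ih, h1, List.count_cons_self]
      simp [Step.rise]
      ring

theorem finite_dyckPaths (k : List ℕ) : {D : List Step | IsDyckPath k D}.Finite := by
  refine (List.finite_toSet
    (k.map Step.red ++ List.replicate k.sum Step.blue).permutations).subset ?_
  rintro D ⟨h1, -, h3⟩
  have h := height_eq D
  rw [h3, h1] at h
  have h' : D.count Step.blue = k.sum := by omega
  have := perm_steps D
  rw [h1, h'] at this
  exact List.mem_permutations.2 this

/-- The finite set of all `k`-Dyck paths. -/
noncomputable def dyckPaths (k : List ℕ) : Finset (List Step) := (finite_dyckPaths k).toFinset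

/-- The variable `q` of `ℤ[q, t]`. -/
noncomputable def q : MvPolynomial (Fin 2) ℤ := MvPolynomial.X 0

/-- The variable `t` of `ℤ[q, t]`. -/
noncomputable def t : MvPolynomial (Fin 2) ℤ := MvPolynomial.X 1

/-- The generalized `q,t`-Catalan number `C_k(q, t)`, the sum of `q ^ area D * t ^ bounce D` over all
`k`-Dyck paths `D`. -/
noncomputable def qtCatalan (k : List ℕ) : MvPolynomial (Fin 2) ℤ :=
  ∑ D ∈ dyckPaths k, q ^ area D * t ^ bounce D

/-- Exchange of `q` and `t`: sends `f(q, t)` to `f(t, q)`. -/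
noncomputable def swapQT (f : MvPolynomial (Fin 2) ℤ) : MvPolynomial (Fin 2) ℤ :=
  MvPolynomial.rename (Equiv.swap (0 : Fin 2) 1) f

/-- The generating function `∑_{k ≥ 0} C_{(k,k,k,k)}(q, t) x ^ k` in `ℤ[q, t][[x]]`. -/
noncomputable def genFun : PowerSeries (MvPolynomial (Fin 2) ℤ) :=
  PowerSeries.mk fun k => qtCatalan (List.replicate 4 k)

/-- The polynomial `N` in `x` over `ℤ[q, t]`, the numerator of the generating function. -/
noncomputable def numerator : Polynomial (MvPolynomial (Fin 2) ℤ) :=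
  1
  + Polynomial.C (q ^ 5 * t + q ^ 4 * t ^ 2 + q ^ 3 * t ^ 3 + q ^ 2 * t ^ 4 + q * t ^ 5
      + q ^ 4 * t + q ^ 3 * t ^ 2 + q ^ 2 * t ^ 3 + q * t ^ 4) * Polynomial.X
  + Polynomial.C (q ^ 6 * t ^ 5 + q ^ 5 * t ^ 6 - q ^ 7 * t ^ 3 - q ^ 6 * t ^ 4 - q ^ 5 * t ^ 5
      - q ^ 4 * t ^ 6 - q ^ 3 * t ^ 7 - q ^ 5 * t ^ 4 - q ^ 4 * t ^ 5) * Polynomial.X ^ 2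
  - Polynomial.C (q ^ 8 * t ^ 8 + q ^ 9 * t ^ 6 + q ^ 8 * t ^ 7 + q ^ 7 * t ^ 8 + q ^ 6 * t ^ 9)
      * Polynomial.X ^ 3

/-- The factor `1 - q ^ i * t ^ j * x` of the denominator of the generating function. -/
noncomputable def factor (i j : ℕ) : Polynomial (MvPolynomial (Fin 2) ℤ) :=
  1 - Polynomial.C (q ^ i * t ^ j) * Polynomial.X

/-- The denominator of the generating function, a polynomial in `x` with constant term `1`. -/
noncomputable def denominator : Polynomial (MvPolynomial (Fin 2) ℤ) :=
  factor 3 1 * factor 2 2 * factor 1 3 * factor 6 0 * factor 0 6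

end QTCatalan

/-!
A path with red arrows of length `k` in the columns `0 ≤ a ≤ b ≤ c` has area `6k - (a + b + c)`, and
the stages `0, l₂, l₃, l₄` in which the bounce path reaches the arrows satisfy an implicit equation
that involves only the columns in which the stages begin. For fixed stages the admissible columns
form intervals, so these paths contribute monomials times `q`-integers. Split according to the order
of the stages modulo `k`, the sum runs over integer points of simplices such as
`0 ≤ a < b < c ≤ k`, with exponents linear in these points, and the generating function in `k` of
such a sum is a product of geometric series, one for each vertex of the simplex; a strict inequality
drops the constant term of one of them. The eleven products add up to the rational function. Its
numerator and denominator are invariant under the exchange of `q` and `t`, hence so is the series.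
-/

namespace QTCatalan

open Finset

/-! ### Paths and their red arrows -/

theorem redLabels_eq_map_redArrowsFrom (w : ℕ) (D : List Step) :
    redLabels D = (redArrowsFrom w D).map Prod.snd := by
  induction D generalizing w with
  | nil => rfl
  | cons s D ih =>
    cases s with
    | red k => exact congrArg (k :: ·) (ih w)
    | blue => exact ih (w + 1)

/-- The red ranks of a path, read off from the list of its red arrows `(p, k)`, where `s` is the
total length of the red arrows that precede the list. -/
def arrowRanks : ℤ → List (ℕ × ℕ) → List ℤ
  | _, [] => []
  | s, a :: A => (s - a.1) :: arrowRanks (s + a.2) A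

theorem redRanksFrom_eq_arrowRanks (r : ℤ) (w : ℕ) (D : List Step) :
    redRanksFrom r D = arrowRanks (r + w) (redArrowsFrom w D) := by
  induction D generalizing r w with
  | nil => rfl
  | cons s D ih =>
    cases s with
    | red k =>
      rw [redRanksFrom, redArrowsFrom, arrowRanks, ih _ w, add_sub_cancel_right, add_right_comm]
    | blue =>
      rw [redRanksFrom, redArrowsFrom, ih _ (w + 1)]
      congr 1
      push_cast
      ring

theorem height_cons (s : Step) (D : List Step) : height (s :: D) = s.rise + height D :=
  List.sum_cons

/-- The height of a path is smallest at its end or just before a red arrow. -/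
theorem forall_prefix_height_nonneg_iff (r : ℤ) (D : List Step) :
    (∀ P, P <+: D → 0 ≤ r + height P) ↔ (∀ x ∈ redRanksFrom r D, 0 ≤ x) ∧ 0 ≤ r + height D := by
  induction D generalizing r with
  | nil => simp [redRanksFrom, height]
  | cons s D ih =>
    have split : (∀ P, P <+: s :: D → 0 ≤ r + height P) ↔
        0 ≤ r ∧ ∀ P, P <+: D → 0 ≤ r + s.rise + height P := by
      simp only [List.prefix_cons_iff, forall_eq_or_imp, forall_exists_index, and_imp,
        forall_comm (α := List Step), forall_eq, height_cons, ← add_assoc]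
      simp [height]
    rw [split, height_cons, ← add_assoc]
    cases s with
    | red k => rw [ih, redRanksFrom, List.forall_mem_cons, and_assoc]; rfl
    | blue =>
      have nonneg_of_tail (h : ∀ P, P <+: D → 0 ≤ r + Step.blue.rise + height P) : 0 ≤ r := by
        have := h [] List.nil_prefix
        simp only [height, Step.rise, List.map_nil, List.sum_nil] at this
        omega
      rw [and_iff_right_of_imp nonneg_of_tail, ih]
      rfl

/-- The path from column `w` to column `m` whose red arrows are the `(p, k) ∈ A`; this presupposes
that the columns `w`, `p`, …, `m` weakly increase. -/
def pathOfArrows (m : ℕ) : ℕ → List (ℕ × ℕ) → List Step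
  | w, [] => List.replicate (m - w) Step.blue
  | w, a :: A => List.replicate (a.1 - w) Step.blue ++ Step.red a.2 :: pathOfArrows m a.1 A

theorem pathOfArrows_eq_blue_cons {m w : ℕ} {A : List (ℕ × ℕ)}
    (h : List.IsChain (· ≤ ·) ((w + 1) :: (A.map Prod.fst ++ [m]))) :
    pathOfArrows m w A = Step.blue :: pathOfArrows m (w + 1) A := by
  cases A with
  | nil =>
    have hwm : w + 1 ≤ m := by simpa using h
    rw [pathOfArrows, pathOfArrows, ← List.replicate_succ]
    congr
    omega
  | cons a A =>
    have hwa : w + 1 ≤ a.1 := h.rel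
    rw [pathOfArrows, pathOfArrows, ← List.cons_append, ← List.replicate_succ]
    congr
    omega

theorem isChain_redArrowsFrom (w : ℕ) (D : List Step) :
    List.IsChain (· ≤ ·) (w :: ((redArrowsFrom w D).map Prod.fst ++ [w + D.count Step.blue])) := by
  induction D generalizing w with
  | nil => simp [redArrowsFrom]
  | cons s D ih =>
    cases s with
    | red k =>
      rw [List.count_cons_of_ne (by simp)]
      exact (ih w).cons_cons le_rfl
    | blue =>
      rw [List.count_cons_self, add_comm _ 1, ← add_assoc]
      exact (ih (w + 1)).imp_head (Nat.le_succ w).trans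

theorem pathOfArrows_redArrowsFrom (w : ℕ) (D : List Step) :
    pathOfArrows (w + D.count Step.blue) w (redArrowsFrom w D) = D := by
  induction D generalizing w with
  | nil => simp [redArrowsFrom, pathOfArrows]
  | cons s D ih =>
    cases s with
    | red k =>
      rw [List.count_cons_of_ne (by simp), redArrowsFrom, pathOfArrows, ih, Nat.sub_self]
      rfl
    | blue =>
      rw [List.count_cons_self, add_comm _ 1, ← add_assoc, redArrowsFrom,
        pathOfArrows_eq_blue_cons (isChain_redArrowsFrom (w + 1) D), ih]

theorem redArrowsFrom_replicate_blue_append (w n : ℕ) (D : List Step) :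
    redArrowsFrom w (List.replicate n Step.blue ++ D) = redArrowsFrom (w + n) D := by
  induction n generalizing w with
  | zero => rfl
  | succ n ih =>
    rw [List.replicate_succ, List.cons_append, redArrowsFrom, ih, add_assoc, add_comm 1]

theorem redArrowsFrom_pathOfArrows {m w : ℕ} {A : List (ℕ × ℕ)}
    (h : List.IsChain (· ≤ ·) (w :: (A.map Prod.fst ++ [m]))) :
    redArrowsFrom w (pathOfArrows m w A) = A := by
  induction A generalizing w with
  | nil =>
    rw [pathOfArrows, ← List.append_nil (List.replicate _ _), redArrowsFrom_replicate_blue_append]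
    rfl
  | cons a A ih =>
    rw [pathOfArrows, redArrowsFrom_replicate_blue_append, Nat.add_sub_cancel' h.rel, redArrowsFrom,
      ih h.tail]

theorem add_count_blue_pathOfArrows {m w : ℕ} {A : List (ℕ × ℕ)}
    (h : List.IsChain (· ≤ ·) (w :: (A.map Prod.fst ++ [m]))) :
    w + (pathOfArrows m w A).count Step.blue = m := by
  induction A generalizing w with
  | nil => rw [pathOfArrows, List.count_replicate_self, Nat.add_sub_cancel' h.rel]
  | cons a A ih =>
    rw [pathOfArrows, List.count_append, List.count_replicate_self,
      List.count_cons_of_ne (by simp), ← add_assoc, Nat.add_sub_cancel' h.rel, ih h.tail]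

theorem isDyckPath_iff_exists_arrows {l : List ℕ} {D : List Step} :
    IsDyckPath l D ↔ ∃ A : List (ℕ × ℕ), A.map Prod.snd = l ∧
      List.IsChain (· ≤ ·) (0 :: (A.map Prod.fst ++ [l.sum])) ∧
      (∀ r ∈ arrowRanks 0 A, 0 ≤ r) ∧ D = pathOfArrows l.sum 0 A := by
  have nonneg_iff := forall_prefix_height_nonneg_iff 0 D
  simp only [zero_add, redRanksFrom_eq_arrowRanks 0 0 D, Nat.cast_zero] at nonneg_iff
  have height_eq := height_eq D
  rw [IsDyckPath, nonneg_iff, redLabels_eq_map_redArrowsFrom 0]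
  constructor
  · rintro ⟨rfl, ⟨hranks, -⟩, hheight⟩
    have hcount : ((redArrowsFrom 0 D).map Prod.snd).sum = 0 + D.count Step.blue := by
      rw [← redLabels_eq_map_redArrowsFrom]
      omega
    refine ⟨redArrowsFrom 0 D, rfl, ?_, hranks, ?_⟩
    · exact hcount ▸ isChain_redArrowsFrom 0 D
    · rw [hcount, pathOfArrows_redArrowsFrom]
  · rintro ⟨A, hA, hchain, hranks, rfl⟩
    have hheight : height (pathOfArrows l.sum 0 A) = 0 := by
      have hcount := add_count_blue_pathOfArrows hchain
      rw [height_eq, redLabels_eq_map_redArrowsFrom 0, redArrowsFrom_pathOfArrows hchain, hA]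
      omega
    rw [redArrowsFrom_pathOfArrows hchain]
    exact ⟨hA, ⟨hranks, hheight.ge⟩, hheight⟩

/-! ### The stages of the bounce path -/

/-- The column in which the bounce path stands at the beginning of stage `i` if the red arrows `A`
are reached in the stages `L`. -/
def stageColumn (A : List (ℕ × ℕ)) (L : List ℕ) (i : ℕ) : ℕ :=
  (List.zipWith (fun a l => min a.2 (i - l)) A L).sum

theorem zipWith_min_succ {A : List (ℕ × ℕ)} {L : List ℕ} {i x : ℕ}
    (h : List.Forall₂ (fun a l => a.1 ≤ x ↔ l ≤ i) A L) :
    List.zipWith (fun a c => if a.1 ≤ x then min a.2 (c + 1) else c) A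
        (List.zipWith (fun a l => min a.2 (i - l)) A L) =
      List.zipWith (fun a l => min a.2 (i + 1 - l)) A L := by
  induction h with
  | nil => rfl
  | cons head _ ih =>
    simp only [List.zipWith_cons_cons, head, ih]
    congr 1
    split_ifs <;> omega

/-- The hypothesis is a fixed-point condition: the stages `L` determine the columns of the bounce
path, which in turn determine the stages. -/
theorem iterate_bounceStage {A : List (ℕ × ℕ)} {L : List ℕ}
    (h : List.Forall₂ (fun a l => ∀ i, a.1 ≤ stageColumn A L i ↔ l ≤ i) A L) (i : ℕ) :
    (bounceStage A)^[i] (List.replicate A.length 0) =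
      List.zipWith (fun a l => min a.2 (i - l)) A L := by
  induction i with
  | zero => exact List.ext_getElem (by simp [h.length_eq]) (by simp)
  | succ i ih =>
    rw [Function.iterate_succ_apply', ih]
    exact zipWith_min_succ (h.imp fun _ _ h => h i)

theorem bounce_eq_sum_levels {D : List Step} {L : List ℕ}
    (h : List.Forall₂ (fun a l => ∀ i, a.1 ≤ stageColumn (redArrows D) L i ↔ l ≤ i)
      (redArrows D) L) :
    bounce D = L.sum := by
  have column (i : ℕ) : bounceColumn D i = stageColumn (redArrows D) L i :=
    congrArg List.sum (iterate_bounceStage h i)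
  have level (a : ℕ × ℕ) (l : ℕ) (hal : ∀ i, a.1 ≤ stageColumn (redArrows D) L i ↔ l ≤ i) :
      bounceLevel D a.1 = l := by
    simp only [bounceLevel, column, hal]
    exact csInf_Ici
  have map_level : (redArrows D).map (fun a => bounceLevel D a.1) = L := by
    rw [← List.forall₂_eq_eq_eq, List.forall₂_map_left_iff]
    exact h.imp level
  rw [bounce, map_level]

/-! ### Paths with four red arrows of equal length -/

/-- The path from column `0` to column `4 * k` with four red arrows of length `k`, in the columns
`0`, `a`, `b`, `c`. -/
def fourPath (k a b c : ℕ) : List Step := pathOfArrows (4 * k) 0 [(0, k), (a, k), (b, k), (c, k)]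

theorem redArrows_fourPath {k a b c : ℕ} (hab : a ≤ b) (hbc : b ≤ c) (hc : c ≤ 4 * k) :
    redArrows (fourPath k a b c) = [(0, k), (a, k), (b, k), (c, k)] :=
  redArrowsFrom_pathOfArrows (by simp; omega)

theorem area_fourPath {k a b c : ℕ} (hab : a ≤ b) (hbc : b ≤ c) (hc : c ≤ 4 * k) :
    area (fourPath k a b c) = 6 * k - (a + b + c) := by
  rw [area, redRanks, redRanksFrom_eq_arrowRanks, ← redArrows, redArrows_fourPath hab hbc hc]
  simp only [arrowRanks, List.sum_cons, List.sum_nil]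
  omega

theorem isDyckPath_replicate_four_iff {k : ℕ} {D : List Step} :
    IsDyckPath (List.replicate 4 k) D ↔ ∃ a ≤ k, ∃ b ≤ 2 * k, ∃ c ≤ 3 * k, a ≤ b ∧ b ≤ c ∧
      fourPath k a b c = D := by
  rw [isDyckPath_iff_exists_arrows, List.sum_replicate, smul_eq_mul]
  constructor
  · rintro ⟨A, hA, hchain, hranks, rfl⟩
    obtain ⟨p₁, p₂, p₃, p₄, rfl⟩ :
        ∃ p₁ p₂ p₃ p₄, A = [(p₁, k), (p₂, k), (p₃, k), (p₄, k)] := by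
      simpa [List.replicate, List.map_eq_cons_iff, Prod.exists] using hA
    simp only [arrowRanks, List.forall_mem_cons] at hranks
    simp only [List.map_cons, List.map_nil, List.cons_append, List.nil_append,
      List.isChain_cons_cons] at hchain
    obtain rfl : p₁ = 0 := by omega
    exact ⟨p₂, by omega, p₃, by omega, p₄, by omega, by omega, by omega, rfl⟩
  · rintro ⟨a, ha, b, hb, c, hc, hab, hbc, rfl⟩
    refine ⟨[(0, k), (a, k), (b, k), (c, k)], rfl, by simp; omega, ?_, rfl⟩
    simp [arrowRanks]
    omega

/-- The contribution of `fourPath k a b c` to the `q,t`-Catalan number. -/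
noncomputable def weight (k a b c : ℕ) : MvPolynomial (Fin 2) ℤ :=
  q ^ (6 * k - (a + b + c)) * t ^ bounce (fourPath k a b c)

theorem qtCatalan_replicate_four (k : ℕ) :
    qtCatalan (List.replicate 4 k) =
      ∑ a ∈ Icc 0 k, ∑ b ∈ Icc a (2 * k), ∑ c ∈ Icc b (3 * k), weight k a b c := by
  simp only [sum_sigma', qtCatalan]
  symm
  refine sum_bij (fun x _ => fourPath k x.1 x.2.1 x.2.2) ?_ ?_ ?_ ?_
  · rintro ⟨a, b, c⟩ h
    simp only [mem_sigma, mem_Icc] at h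
    rw [dyckPaths, Set.Finite.mem_toFinset]
    exact isDyckPath_replicate_four_iff.2
      ⟨a, by omega, b, by omega, c, by omega, by omega, by omega, rfl⟩
  · rintro ⟨a, b, c⟩ h ⟨a', b', c'⟩ h' heq
    simp only [mem_sigma, mem_Icc] at h h'
    have hred := congrArg redArrows heq
    dsimp only at hred
    rw [redArrows_fourPath (by omega) (by omega) (by omega),
      redArrows_fourPath (by omega) (by omega) (by omega)] at hred
    simp only [List.cons.injEq, Prod.mk.injEq] at hred
    obtain ⟨-, ⟨rfl, -⟩, ⟨rfl, -⟩, ⟨rfl, -⟩, -⟩ := hred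
    rfl
  · intro D hD
    rw [dyckPaths, Set.Finite.mem_toFinset] at hD
    obtain ⟨a, ha, b, hb, c, hc, hab, hbc, rfl⟩ := isDyckPath_replicate_four_iff.1 hD
    exact ⟨⟨a, b, c⟩, by simp only [mem_sigma, mem_Icc]; omega, rfl⟩
  · rintro ⟨a, b, c⟩ h
    simp only [mem_sigma, mem_Icc] at h
    dsimp only
    rw [weight, area_fourPath (by omega) (by omega) (by omega)]

/-- The column in which the bounce path stands at the beginning of stage `i` if it reaches red
arrows of length `k` in the stages `L`. -/
def equalStageColumn (k : ℕ) (L : List ℕ) (i : ℕ) : ℕ := (L.map fun l => min k (i - l)).sum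

theorem equalStageColumn_cons (k l : ℕ) (L : List ℕ) (i : ℕ) :
    equalStageColumn k (l :: L) i = min k (i - l) + equalStageColumn k L i :=
  List.sum_cons

theorem equalStageColumn_nil (k i : ℕ) : equalStageColumn k [] i = 0 := rfl

theorem equalStageColumn_mono (k : ℕ) (L : List ℕ) : Monotone (equalStageColumn k L) :=
  fun _ _ hij => List.sum_le_sum fun _ _ => min_le_min_left _ (Nat.sub_le_sub_right hij _)

/-- A red arrow does not influence the stages in which the preceding red arrows are reached. -/
theorem bounce_fourPath {k a b c l₂ l₃ l₄ : ℕ} (hab : a ≤ b) (hbc : b ≤ c) (hc : c ≤ 4 * k)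
    (h₂ : ∀ i, a ≤ equalStageColumn k [0] i ↔ l₂ ≤ i)
    (h₃ : ∀ i, b ≤ equalStageColumn k [0, l₂] i ↔ l₃ ≤ i)
    (h₄ : ∀ i, c ≤ equalStageColumn k [0, l₂, l₃] i ↔ l₄ ≤ i) :
    bounce (fourPath k a b c) = l₂ + l₃ + l₄ := by
  simp only [equalStageColumn_cons, equalStageColumn_nil] at h₂ h₃ h₄
  have hl₂₃ : l₂ ≤ l₃ := by
    have := h₂ l₃
    have := h₃ l₃
    omega
  have hl₃₄ : l₃ ≤ l₄ := by
    have := h₃ l₄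
    have := h₄ l₄
    omega
  rw [show l₂ + l₃ + l₄ = [0, l₂, l₃, l₄].sum by simp [add_assoc]]
  refine bounce_eq_sum_levels ?_
  simp only [redArrows_fourPath hab hbc hc, stageColumn, List.forall₂_cons, List.Forall₂.nil,
    List.zipWith_cons_cons, List.zipWith_nil_left, List.sum_cons, List.sum_nil, and_true]
  refine ⟨fun i => ?_, fun i => ?_, fun i => ?_, fun i => ?_⟩
  · omega
  · have := h₂ i
    omega
  · have := h₃ i
    omega
  · have := h₄ i
    omega

/-! ### Summation over the stages -/

theorem sum_Icc_eq_add_sum_Ioc {M : Type*} [AddCommMonoid M] (f : ℕ → M) {a b c : ℕ} (hab : a ≤ b)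
    (hbc : b ≤ c) :
    ∑ p ∈ Icc a c, f p = ∑ p ∈ Icc a b, f p + ∑ p ∈ Ioc b c, f p := by
  have disjoint : Disjoint (Icc a b) (Ioc b c) :=
    disjoint_left.2 fun p hp hp' => (mem_Icc.1 hp).2.not_gt (mem_Ioc.1 hp').1
  rw [← sum_union disjoint]
  congr 1
  exact coe_injective (by simp [Set.Icc_union_Ioc_eq_Icc hab hbc])

section Stages

variable {X : ℕ → ℕ}

theorem sum_Ioc_eq_sum_stages {M : Type*} [AddCommMonoid M] (hX : Monotone X) (f : ℕ → M) {i j : ℕ}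
    (hij : i ≤ j) :
    ∑ p ∈ Ioc (X i) (X j), f p = ∑ l ∈ Ioc i j, ∑ p ∈ Ioc (X (l - 1)) (X l), f p := by
  induction j, hij using Nat.le_induction with
  | base => simp
  | succ j hij ih =>
    rw [sum_Ioc_succ_top hij, ← ih, Nat.add_sub_cancel,
      sum_Ioc_consecutive _ (hX hij) (hX j.le_succ)]

theorem le_iff_le_of_mem_Ioc (hX : Monotone X) {p l : ℕ} (hp : p ∈ Ioc (X (l - 1)) (X l)) (i : ℕ) :
    p ≤ X i ↔ l ≤ i := by
  rw [mem_Ioc] at hp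
  refine ⟨fun hpi => ?_, fun hli => hp.2.trans (hX hli)⟩
  by_contra! hil
  exact (hp.1.trans_le hpi).not_ge (hX (Nat.le_sub_one_of_lt hil))

end Stages

section GeometricSums

variable {R : Type*} [CommSemiring R]

theorem sum_Ioc_pow_sub (x : R) {u v e : ℕ} (hve : v ≤ e) :
    ∑ p ∈ Ioc u v, x ^ (e - p) = (∑ j ∈ range (v - u), x ^ j) * x ^ (e - v) := by
  rw [sum_mul]
  refine sum_nbij' (v - ·) (v - ·) ?_ ?_ ?_ ?_ ?_ <;> simp only [mem_Ioc, mem_range]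
  · omega
  · omega
  · omega
  · omega
  · intro p hp
    rw [← pow_add]
    congr 1
    omega

theorem sum_Ioc_sum_Icc_pow_sub (x : R) {u v e : ℕ} (hve : 2 * v ≤ e) :
    ∑ b ∈ Ioc u v, ∑ c ∈ Icc b v, x ^ (e - (b + c)) =
      (∑ i ∈ range (v - u), ∑ j ∈ range (i + 1), x ^ (i + j)) * x ^ (e - 2 * v) := by
  rw [sum_mul]
  refine sum_nbij' (v - ·) (v - ·) ?_ ?_ ?_ ?_ ?_ <;> simp only [mem_Ioc, mem_range]
  · omega
  · omega
  · omega
  · omega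
  · intro b hb
    rw [sum_mul]
    refine sum_nbij' (v - ·) (v - ·) ?_ ?_ ?_ ?_ ?_ <;> simp only [mem_Icc, mem_range]
    · omega
    · omega
    · omega
    · omega
    · intro c hc
      rw [← pow_add]
      congr 1
      omega

end GeometricSums

/-- The monomial `q ^ i * t ^ j`. -/
noncomputable def qtMonomial (i j : ℕ) : MvPolynomial (Fin 2) ℤ := q ^ i * t ^ j

/-- The `q`-integer `[n] = 1 + q + ⋯ + q ^ (n - 1)`. -/
noncomputable def qInt (n : ℕ) : MvPolynomial (Fin 2) ℤ := ∑ j ∈ range n, q ^ j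

/-- The Gaussian binomial coefficient `[n + 1 choose 2]`, as a sum over the pairs `j ≤ i < n`. -/
noncomputable def qPairs (n : ℕ) : MvPolynomial (Fin 2) ℤ :=
  ∑ i ∈ range n, ∑ j ∈ range (i + 1), q ^ (i + j)

/-- The number of columns that the bounce path passes between the beginnings of the stages `i - 1`
and `i` if it reaches red arrows of length `k` in the stages `L`. -/
def stageWidth (k : ℕ) (L : List ℕ) (i : ℕ) : ℕ :=
  equalStageColumn k L i - equalStageColumn k L (i - 1)

theorem weight_eq_of_levels {k a b c l m : ℕ} (ha : a ≤ k) (hab : a ≤ b) (hbc : b ≤ c)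
    (hc : c ≤ 3 * k) (hl : ∀ i, b ≤ equalStageColumn k [0, a] i ↔ l ≤ i)
    (hm : ∀ i, c ≤ equalStageColumn k [0, a, l] i ↔ m ≤ i) :
    weight k a b c = q ^ (6 * k - (a + b + c)) * t ^ (a + l + m) := by
  rw [weight, bounce_fourPath hab hbc (by omega) (fun i => ?_) hl hm]
  simp only [equalStageColumn_cons, equalStageColumn_nil]
  omega

theorem sum_weight_of_level {k a b l : ℕ} (ha : a ≤ k) (hab : a ≤ b) (hb : b ≤ 2 * k)
    (hl : ∀ i, b ≤ equalStageColumn k [0, a] i ↔ l ≤ i) :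
    ∑ c ∈ Icc b (3 * k), weight k a b c =
      ∑ c ∈ Icc b (equalStageColumn k [0, a] l), q ^ (6 * k - (a + b + c)) * t ^ (a + 2 * l) +
      ∑ m ∈ Ioc l (l + k), qInt (stageWidth k [0, a, l] m) *
        qtMonomial (6 * k - (a + b + equalStageColumn k [0, a, l] m)) (a + l + m) := by
  set X := equalStageColumn k [0, a] with hX
  set Y := equalStageColumn k [0, a, l] with hY
  have hXl : b ≤ X l := (hl l).2 le_rfl
  have hYm (m : ℕ) : Y m ≤ 3 * k := by
    simp only [hY, equalStageColumn_cons, equalStageColumn_nil]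
    omega
  have hYX (i : ℕ) : Y i = X i + min k (i - l) := by
    simp only [hX, hY, equalStageColumn_cons, equalStageColumn_nil]
    omega
  have hYl : Y l = X l := by simp [hYX]
  have hYlk : Y (l + k) = 3 * k := by
    simp only [hX, hY, equalStageColumn_cons, equalStageColumn_nil] at hXl ⊢
    omega
  have hYmono : Monotone Y := equalStageColumn_mono k _
  rw [sum_Icc_eq_add_sum_Ioc _ hXl (hYl ▸ hYlk ▸ hYmono le_self_add), ← hYl, ← hYlk,
    sum_Ioc_eq_sum_stages hYmono _ le_self_add]
  congr 1
  · refine sum_congr rfl fun c hc => ?_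
    rw [mem_Icc] at hc
    have level (i : ℕ) : c ≤ Y i ↔ l ≤ i := by
      have := hl i
      have := hYX i
      have := hYmono (a := l) (b := i)
      omega
    rw [weight_eq_of_levels ha hab hc.1 (hc.2.trans (hYm l)) hl level, two_mul, ← add_assoc a l l]
  · refine sum_congr rfl fun m hm => ?_
    rw [qtMonomial, ← mul_assoc, qInt, stageWidth, ← hY, ← Nat.sub_sub,
      ← sum_Ioc_pow_sub q (by have := hYm m; omega), sum_mul]
    refine sum_congr rfl fun c hc => ?_
    rw [mem_Ioc] at hm
    have hYlm : Y l ≤ Y (m - 1) := hYmono (Nat.le_sub_one_of_lt hm.1)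
    have level := le_iff_le_of_mem_Ioc hYmono hc
    rw [mem_Ioc] at hc
    rw [Nat.sub_sub, weight_eq_of_levels ha hab (by omega) (hc.2.trans (hYm m)) hl level]

theorem sum_weight_self_eq_sum_stages {k a : ℕ} (ha : a ≤ k) :
    ∑ c ∈ Icc a (3 * k), weight k a a c =
      qtMonomial (6 * k - 3 * a) (3 * a) +
      ∑ m ∈ Ioc a (a + k), qInt (stageWidth k [0, a, a] m) *
        qtMonomial (6 * k - (2 * a + equalStageColumn k [0, a, a] m)) (2 * a + m) := by
  have column_a : equalStageColumn k [0, a] a = a := by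
    simpa [equalStageColumn_cons, equalStageColumn_nil] using ha
  have level (i : ℕ) : a ≤ equalStageColumn k [0, a] i ↔ a ≤ i := by
    simp only [equalStageColumn_cons, equalStageColumn_nil]
    omega
  rw [sum_weight_of_level ha le_rfl (by omega) level, column_a, Icc_self, sum_singleton, qtMonomial]
  simp only [← two_mul]
  congr 4 <;> ring

theorem sum_weight_of_stage {k a l : ℕ} (ha : a ≤ k) (hl : a < l) :
    ∑ b ∈ Ioc (equalStageColumn k [0, a] (l - 1)) (equalStageColumn k [0, a] l),
        ∑ c ∈ Icc b (3 * k), weight k a b c =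
      qPairs (stageWidth k [0, a] l) *
        qtMonomial (6 * k - (a + 2 * equalStageColumn k [0, a] l)) (a + 2 * l) +
      ∑ m ∈ Ioc l (l + k), qInt (stageWidth k [0, a] l) * qInt (stageWidth k [0, a, l] m) *
        qtMonomial (6 * k - (a + equalStageColumn k [0, a] l + equalStageColumn k [0, a, l] m))
          (a + l + m) := by
  set X := equalStageColumn k [0, a] with hX
  set Y := equalStageColumn k [0, a, l] with hY
  have hXmono : Monotone X := equalStageColumn_mono k _
  have hXa : a ≤ X (l - 1) := by
    simp only [hX, equalStageColumn_cons, equalStageColumn_nil]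
    omega
  have hXl : X l ≤ 2 * k := by
    simp only [hX, equalStageColumn_cons, equalStageColumn_nil]
    omega
  have hYm (m : ℕ) : Y m ≤ 3 * k := by
    simp only [hY, equalStageColumn_cons, equalStageColumn_nil]
    omega
  have inner (b : ℕ) (hb : b ∈ Ioc (X (l - 1)) (X l)) :=
    sum_weight_of_level ha (hXa.trans (mem_Ioc.1 hb).1.le) ((mem_Ioc.1 hb).2.trans hXl)
      (le_iff_le_of_mem_Ioc hXmono hb)
  rw [sum_congr rfl inner, sum_add_distrib, sum_comm]
  congr 1
  · rw [qtMonomial, ← mul_assoc, qPairs, stageWidth, ← hX, ← Nat.sub_sub,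
      ← sum_Ioc_sum_Icc_pow_sub q (by omega)]
    simp only [sum_mul, Nat.sub_sub, add_assoc]
  · refine sum_congr rfl fun m _ => ?_
    have sum_b : ∑ b ∈ Ioc (X (l - 1)) (X l), q ^ (6 * k - (a + b + Y m)) =
        qInt (stageWidth k [0, a] l) * q ^ (6 * k - (a + X l + Y m)) := by
      have := hYm m
      simp only [add_right_comm a _ (Y m), ← Nat.sub_sub _ (a + Y m)]
      exact sum_Ioc_pow_sub q (by omega)
    simp only [qtMonomial]
    rw [← mul_sum, ← sum_mul, sum_b]
    ring

theorem qtCatalan_replicate_four_eq_sum_stages (k : ℕ) :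
    qtCatalan (List.replicate 4 k) = ∑ a ∈ Icc 0 k,
      (∑ c ∈ Icc a (3 * k), weight k a a c +
      ∑ l ∈ Ioc a (a + k),
        ∑ b ∈ Ioc (equalStageColumn k [0, a] (l - 1)) (equalStageColumn k [0, a] l),
          ∑ c ∈ Icc b (3 * k), weight k a b c) := by
  rw [qtCatalan_replicate_four]
  refine sum_congr rfl fun a ha => ?_
  rw [mem_Icc] at ha
  have column_left : equalStageColumn k [0, a] a = a := by
    simpa [equalStageColumn_cons, equalStageColumn_nil] using ha.2
  have column_right : equalStageColumn k [0, a] (a + k) = 2 * k := by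
    simp [equalStageColumn_cons, equalStageColumn_nil, two_mul]
  rw [sum_Icc_eq_add_sum_Ioc _ le_rfl (by omega), Icc_self, sum_singleton]
  congr 1
  nth_rw 1 [← column_left]
  rw [← column_right, sum_Ioc_eq_sum_stages (equalStageColumn_mono k _) _ le_self_add]

theorem stageWidth_nil (k i : ℕ) : stageWidth k [] i = 0 := rfl

theorem stageWidth_cons (k l : ℕ) (L : List ℕ) (i : ℕ) :
    stageWidth k (l :: L) i = (if l < i ∧ i ≤ l + k then 1 else 0) + stageWidth k L i := by
  have := equalStageColumn_mono k L i.pred_le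
  simp only [stageWidth, equalStageColumn_cons, Nat.pred_eq_sub_one] at this ⊢
  split_ifs <;> omega

theorem sum_Ioc_add_left {M : Type*} [AddCommMonoid M] (f : ℕ → M) (k u v : ℕ) :
    ∑ m ∈ Ioc (k + u) (k + v), f m = ∑ c ∈ Ioc u v, f (k + c) := by
  rw [← map_add_left_Ioc, sum_map]
  rfl

theorem sum_Ioc_add_right {M : Type*} [AddCommMonoid M] (f : ℕ → M) {u k : ℕ} (v : ℕ)
    (huk : u ≤ k) :
    ∑ m ∈ Ioc u (v + k), f m = ∑ c ∈ Ioc u k, f c + ∑ c ∈ Ioc 0 v, f (k + c) := by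
  rw [← sum_Ioc_consecutive f huk (Nat.le_add_left k v), add_comm v k, ← sum_Ioc_add_left f k 0 v,
    add_zero]

theorem sum_weight_self {k a : ℕ} (ha : a ≤ k) :
    ∑ c ∈ Icc a (3 * k), weight k a a c =
      qtMonomial (6 * k - 3 * a) (3 * a) +
      ∑ c ∈ Ioc a k, qInt 3 * qtMonomial (6 * k - 3 * c) (2 * a + c) +
      ∑ c ∈ Ioc 0 a, qInt 2 * qtMonomial (3 * k - 2 * c) (2 * a + k + c) := by
  rw [sum_weight_self_eq_sum_stages ha, sum_Ioc_add_right _ a ha, ← add_assoc]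
  refine congrArg₂ _ (congrArg₂ _ rfl (sum_congr rfl fun c hc => ?_)) (sum_congr rfl fun c hc => ?_)
  all_goals
    rw [mem_Ioc] at hc
    refine congrArg₂ _ (congrArg qInt ?_) (congrArg₂ qtMonomial ?_ ?_)
    · simp only [stageWidth_cons, stageWidth_nil]
      split_ifs <;> omega
    · simp only [equalStageColumn_cons, equalStageColumn_nil]
      omega
    · omega

theorem sum_weight_of_stage_le {k a b : ℕ} (hab : a < b) (hb : b ≤ k) :
    ∑ p ∈ Ioc (equalStageColumn k [0, a] (b - 1)) (equalStageColumn k [0, a] b),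
        ∑ c ∈ Icc p (3 * k), weight k a p c =
      qPairs 2 * qtMonomial (6 * k + a - 4 * b) (a + 2 * b) +
      ∑ c ∈ Ioc b k, qInt 2 * qInt 3 * qtMonomial (6 * k + a - b - 3 * c) (a + b + c) +
      ∑ c ∈ Ioc 0 a, qInt 2 * qInt 2 * qtMonomial (3 * k + a - b - 2 * c) (a + b + k + c) +
      ∑ c ∈ Ioc a b, qInt 2 * qInt 1 * qtMonomial (3 * k - b - c) (a + b + k + c) := by
  have column_b : equalStageColumn k [0, a] b = 2 * b - a := by
    simp only [equalStageColumn_cons, equalStageColumn_nil]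
    omega
  have width_b : stageWidth k [0, a] b = 2 := by
    simp only [stageWidth_cons, stageWidth_nil]
    split_ifs <;> omega
  rw [sum_weight_of_stage (hab.le.trans hb) hab, width_b, sum_Ioc_add_right _ b hb,
    ← sum_Ioc_consecutive _ a.zero_le hab.le, ← add_assoc, ← add_assoc, column_b]
  refine congrArg₂ _ (congrArg₂ _ (congrArg₂ _ ?_ (sum_congr rfl fun c hc => ?_))
    (sum_congr rfl fun c hc => ?_)) (sum_congr rfl fun c hc => ?_)
  · refine congrArg _ (congrArg₂ qtMonomial ?_ rfl)
    omega
  all_goals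
    rw [mem_Ioc] at hc
    refine congrArg₂ _ (congrArg _ (congrArg qInt ?_)) (congrArg₂ qtMonomial ?_ ?_)
    · simp only [stageWidth_cons, stageWidth_nil]
      split_ifs <;> omega
    · simp only [equalStageColumn_cons, equalStageColumn_nil]
      omega
    · omega

theorem sum_weight_of_stage_add {k a b : ℕ} (hb : 0 < b) (hba : b ≤ a) (ha : a ≤ k) :
    ∑ p ∈ Ioc (equalStageColumn k [0, a] (k + b - 1)) (equalStageColumn k [0, a] (k + b)),
        ∑ c ∈ Icc p (3 * k), weight k a p c =
      qPairs 1 * qtMonomial (2 * k + a - 2 * b) (a + 2 * k + 2 * b) +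
      ∑ c ∈ Ioc b a, qInt 1 * qInt 2 * qtMonomial (2 * k + a - 2 * c) (a + b + 2 * k + c) +
      ∑ c ∈ Ioc a k, qInt 1 * qInt 1 * qtMonomial (2 * k - c) (a + b + 2 * k + c) +
      ∑ c ∈ Ioc 0 b, qInt 1 * qInt 1 * qtMonomial (k - c) (a + b + 3 * k + c) := by
  have column_b : equalStageColumn k [0, a] (k + b) = 2 * k + b - a := by
    simp only [equalStageColumn_cons, equalStageColumn_nil]
    omega
  have width_b : stageWidth k [0, a] (k + b) = 1 := by
    simp only [stageWidth_cons, stageWidth_nil]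
    split_ifs <;> omega
  rw [sum_weight_of_stage ha (by omega), width_b, add_assoc k b k,
    sum_Ioc_add_left, sum_Ioc_add_right _ b (hba.trans ha), ← sum_Ioc_consecutive _ hba ha,
    ← add_assoc, ← add_assoc, column_b]
  refine congrArg₂ _ (congrArg₂ _ (congrArg₂ _ ?_ (sum_congr rfl fun c hc => ?_))
    (sum_congr rfl fun c hc => ?_)) (sum_congr rfl fun c hc => ?_)
  · refine congrArg _ (congrArg₂ qtMonomial ?_ ?_) <;> omega
  all_goals
    rw [mem_Ioc] at hc
    refine congrArg₂ _ (congrArg _ (congrArg qInt ?_)) (congrArg₂ qtMonomial ?_ ?_)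
    · simp only [stageWidth_cons, stageWidth_nil]
      split_ifs <;> omega
    · simp only [equalStageColumn_cons, equalStageColumn_nil]
      omega
    · omega

theorem qtCatalan_replicate_four_eq_sum_chains (k : ℕ) :
    qtCatalan (List.replicate 4 k) = ∑ a ∈ Icc 0 k,
      (qtMonomial (6 * k - 3 * a) (3 * a) +
        ∑ c ∈ Ioc a k, qInt 3 * qtMonomial (6 * k - 3 * c) (2 * a + c) +
        ∑ c ∈ Ioc 0 a, qInt 2 * qtMonomial (3 * k - 2 * c) (2 * a + k + c) +
      (∑ b ∈ Ioc a k, (qPairs 2 * qtMonomial (6 * k + a - 4 * b) (a + 2 * b) +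
        ∑ c ∈ Ioc b k, qInt 2 * qInt 3 * qtMonomial (6 * k + a - b - 3 * c) (a + b + c) +
        ∑ c ∈ Ioc 0 a, qInt 2 * qInt 2 * qtMonomial (3 * k + a - b - 2 * c) (a + b + k + c) +
        ∑ c ∈ Ioc a b, qInt 2 * qInt 1 * qtMonomial (3 * k - b - c) (a + b + k + c)) +
      ∑ b ∈ Ioc 0 a, (qPairs 1 * qtMonomial (2 * k + a - 2 * b) (a + 2 * k + 2 * b) +
        ∑ c ∈ Ioc b a, qInt 1 * qInt 2 * qtMonomial (2 * k + a - 2 * c) (a + b + 2 * k + c) +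
        ∑ c ∈ Ioc a k, qInt 1 * qInt 1 * qtMonomial (2 * k - c) (a + b + 2 * k + c) +
        ∑ c ∈ Ioc 0 b, qInt 1 * qInt 1 * qtMonomial (k - c) (a + b + 3 * k + c)))) := by
  rw [qtCatalan_replicate_four_eq_sum_stages]
  refine sum_congr rfl fun a ha => ?_
  have hak := (mem_Icc.1 ha).2
  rw [sum_Ioc_add_right _ a hak]
  exact congrArg₂ _ (sum_weight_self hak) (congrArg₂ _
    (sum_congr rfl fun b hb => sum_weight_of_stage_le (mem_Ioc.1 hb).1 (mem_Ioc.1 hb).2)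
    (sum_congr rfl fun b hb => sum_weight_of_stage_add (mem_Ioc.1 hb).1 (mem_Ioc.1 hb).2 hak))

/-! ### Geometric series over chains -/

section Geometric

variable {R : Type*} [CommRing R]

/-- The tail `∑ n ≥ d, m ^ n * X ^ n` of the geometric series of ratio `m * X`. -/
def geomTail (d : ℕ) (m : R) : PowerSeries R := PowerSeries.mk fun n => if d ≤ n then m ^ n else 0

theorem mk_mul_geomTail (f : ℕ → R) (d : ℕ) (m : R) :
    PowerSeries.mk f * geomTail d m =
      PowerSeries.mk fun k => ∑ z ∈ range (k + 1 - d), f z * m ^ (k - z) := by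
  ext k
  rw [PowerSeries.coeff_mul, Nat.sum_antidiagonal_eq_sum_range_succ_mk]
  simp only [geomTail, PowerSeries.coeff_mk, mul_ite, mul_zero, ← sum_filter]
  congr 1
  ext z
  simp only [mem_filter, mem_range]
  omega

theorem geomTail_mul_geomTail (d e : ℕ) (m n : R) :
    geomTail d m * geomTail e n =
      PowerSeries.mk fun k => ∑ z ∈ Ico d (k + 1 - e), m ^ z * n ^ (k - z) := by
  rw [geomTail, mk_mul_geomTail]
  ext k
  simp only [PowerSeries.coeff_mk, ite_mul, zero_mul, ← sum_filter]
  congr 1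
  ext z
  simp only [mem_filter, mem_range, mem_Ico]
  omega

theorem geomTail_mul_one_sub (d : ℕ) (m : R) :
    geomTail d m * (1 - PowerSeries.C m * PowerSeries.X) =
      (PowerSeries.C m * PowerSeries.X) ^ d := by
  rw [mul_pow, ← map_pow, mul_sub, mul_one, mul_left_comm]
  ext (_ | n)
  · obtain rfl | hd := Nat.eq_zero_or_pos d
    · simp [geomTail]
    · simp [geomTail, hd.ne']
  · simp only [geomTail, map_sub, PowerSeries.coeff_C_mul, PowerSeries.coeff_succ_mul_X,
      PowerSeries.coeff_mk, PowerSeries.coeff_X_pow]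
    obtain h | rfl | h := lt_trichotomy d (n + 1)
    · rw [if_pos h.le, if_pos (Nat.le_of_lt_succ h), if_neg h.ne', pow_succ']
      ring
    · simp
    · rw [if_neg h.not_ge, if_neg (by omega), if_neg h.ne]
      ring

theorem one_sub_map_ne_zero {K : Type*} [Field K] (ψ : PowerSeries R →+* K) (m : R) :
    1 - ψ (PowerSeries.C m) * ψ PowerSeries.X ≠ 0 := by
  have h := congrArg ψ (geomTail_mul_one_sub 0 m)
  simp only [map_mul, map_sub, map_one, pow_zero] at h
  exact right_ne_zero_of_mul_eq_one h

theorem map_geomTail {K : Type*} [Field K] (ψ : PowerSeries R →+* K) (d : ℕ) (m : R) :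
    ψ (geomTail d m) = (ψ (PowerSeries.C m) * ψ PowerSeries.X) ^ d /
      (1 - ψ (PowerSeries.C m) * ψ PowerSeries.X) := by
  have h := congrArg ψ (geomTail_mul_one_sub d m)
  simp only [map_mul, map_sub, map_one, map_pow] at h
  exact eq_div_of_mul_eq (one_sub_map_ne_zero ψ m) h

end Geometric

theorem qtMonomial_pow (i j n : ℕ) : qtMonomial i j ^ n = qtMonomial (i * n) (j * n) := by
  rw [qtMonomial, qtMonomial, mul_pow, ← pow_mul, ← pow_mul]

theorem qtMonomial_mul (i j i' j' : ℕ) :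
    qtMonomial i j * qtMonomial i' j' = qtMonomial (i + i') (j + j') := by
  simp only [qtMonomial]
  ring

theorem mk_sum_a_le :
    (PowerSeries.mk fun k => ∑ a ∈ Icc 0 k, qtMonomial (6 * k - 3 * a) (3 * a)) =
    geomTail 0 (qtMonomial 3 3) * geomTail 0 (qtMonomial 6 0) := by
  simp only [geomTail_mul_geomTail]
  ext1 k
  simp only [PowerSeries.coeff_mk, qtMonomial_pow, qtMonomial_mul]
  refine sum_congr rfl fun a ha => ?_
  rw [mem_Ico] at ha
  congr 1 <;> omega

theorem mk_sum_a_lt_c :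
    (PowerSeries.mk fun k => ∑ a ∈ Icc 0 k, ∑ c ∈ Ioc a k,
      qtMonomial (6 * k - 3 * c) (2 * a + c)) =
    geomTail 0 (qtMonomial 3 3) * geomTail 1 (qtMonomial 3 1) *
      geomTail 0 (qtMonomial 6 0) := by
  simp only [geomTail_mul_geomTail, mk_mul_geomTail]
  ext1 k
  simp only [PowerSeries.coeff_mk, sum_mul, sum_sigma', qtMonomial_pow, qtMonomial_mul]
  refine sum_nbij' (fun x => ⟨x.2, x.1⟩) (fun x => ⟨x.2, x.1⟩) ?_ ?_
    (fun _ _ => rfl) (fun _ _ => rfl) fun x hx => ?_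
  all_goals simp only [mem_sigma, mem_Icc, mem_Ico, mem_Ioc, mem_range] at *
  · omega
  · omega
  · congr 1 <;> omega

theorem mk_sum_c_le_a :
    (PowerSeries.mk fun k => ∑ a ∈ Icc 0 k, ∑ c ∈ Ioc 0 a,
      qtMonomial (3 * k - 2 * c) (2 * a + k + c)) =
    geomTail 1 (qtMonomial 1 4) * geomTail 0 (qtMonomial 3 3) *
      geomTail 0 (qtMonomial 3 1) := by
  simp only [geomTail_mul_geomTail, mk_mul_geomTail]
  ext1 k
  simp only [PowerSeries.coeff_mk, sum_mul, sum_sigma', qtMonomial_pow, qtMonomial_mul]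
  refine sum_nbij' (fun x => x) (fun x => x) ?_ ?_
    (fun _ _ => rfl) (fun _ _ => rfl) fun x hx => ?_
  all_goals simp only [mem_sigma, mem_Icc, mem_Ico, mem_Ioc, mem_range] at *
  · omega
  · omega
  · congr 1 <;> omega

theorem mk_sum_a_lt_b :
    (PowerSeries.mk fun k => ∑ a ∈ Icc 0 k, ∑ b ∈ Ioc a k,
      qtMonomial (6 * k + a - 4 * b) (a + 2 * b)) =
    geomTail 0 (qtMonomial 3 3) * geomTail 1 (qtMonomial 2 2) *
      geomTail 0 (qtMonomial 6 0) := by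
  simp only [geomTail_mul_geomTail, mk_mul_geomTail]
  ext1 k
  simp only [PowerSeries.coeff_mk, sum_mul, sum_sigma', qtMonomial_pow, qtMonomial_mul]
  refine sum_nbij' (fun x => ⟨x.2, x.1⟩) (fun x => ⟨x.2, x.1⟩) ?_ ?_
    (fun _ _ => rfl) (fun _ _ => rfl) fun x hx => ?_
  all_goals simp only [mem_sigma, mem_Icc, mem_Ico, mem_Ioc, mem_range] at *
  · omega
  · omega
  · congr 1 <;> omega

theorem mk_sum_a_lt_b_lt_c :
    (PowerSeries.mk fun k => ∑ a ∈ Icc 0 k, ∑ b ∈ Ioc a k, ∑ c ∈ Ioc b k,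
      qtMonomial (6 * k + a - b - 3 * c) (a + b + c)) =
    geomTail 0 (qtMonomial 3 3) * geomTail 1 (qtMonomial 2 2) *
      geomTail 1 (qtMonomial 3 1) * geomTail 0 (qtMonomial 6 0) := by
  simp only [geomTail_mul_geomTail, mk_mul_geomTail]
  ext1 k
  simp only [PowerSeries.coeff_mk, sum_mul, sum_sigma', qtMonomial_pow, qtMonomial_mul]
  refine sum_nbij' (fun x => ⟨x.2.2, x.2.1, x.1⟩) (fun x => ⟨x.2.2, x.2.1, x.1⟩) ?_ ?_
    (fun _ _ => rfl) (fun _ _ => rfl) fun x hx => ?_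
  all_goals simp only [mem_sigma, mem_Icc, mem_Ico, mem_Ioc, mem_range] at *
  · omega
  · omega
  · congr 1 <;> omega

theorem mk_sum_c_le_a_lt_b :
    (PowerSeries.mk fun k => ∑ a ∈ Icc 0 k, ∑ b ∈ Ioc a k, ∑ c ∈ Ioc 0 a,
      qtMonomial (3 * k + a - b - 2 * c) (a + b + k + c)) =
    geomTail 1 (qtMonomial 1 4) * geomTail 0 (qtMonomial 3 3) *
      geomTail 1 (qtMonomial 2 2) * geomTail 0 (qtMonomial 3 1) := by
  simp only [geomTail_mul_geomTail, mk_mul_geomTail]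
  ext1 k
  simp only [PowerSeries.coeff_mk, sum_mul, sum_sigma', qtMonomial_pow, qtMonomial_mul]
  refine sum_nbij' (fun x => ⟨x.2.1, x.1, x.2.2⟩) (fun x => ⟨x.2.1, x.1, x.2.2⟩) ?_ ?_
    (fun _ _ => rfl) (fun _ _ => rfl) fun x hx => ?_
  all_goals simp only [mem_sigma, mem_Icc, mem_Ico, mem_Ioc, mem_range] at *
  · omega
  · omega
  · congr 1 <;> omega

theorem mk_sum_a_lt_c_le_b :
    (PowerSeries.mk fun k => ∑ a ∈ Icc 0 k, ∑ b ∈ Ioc a k, ∑ c ∈ Ioc a b,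
      qtMonomial (3 * k - b - c) (a + b + k + c)) =
    geomTail 0 (qtMonomial 1 4) * geomTail 1 (qtMonomial 1 3) *
      geomTail 0 (qtMonomial 2 2) * geomTail 0 (qtMonomial 3 1) := by
  simp only [geomTail_mul_geomTail, mk_mul_geomTail]
  ext1 k
  simp only [PowerSeries.coeff_mk, sum_mul, sum_sigma', qtMonomial_pow, qtMonomial_mul]
  refine sum_nbij' (fun x => ⟨x.2.1, x.2.2, x.1⟩) (fun x => ⟨x.2.2, x.1, x.2.1⟩) ?_ ?_
    (fun _ _ => rfl) (fun _ _ => rfl) fun x hx => ?_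
  all_goals simp only [mem_sigma, mem_Icc, mem_Ico, mem_Ioc, mem_range] at *
  · omega
  · omega
  · congr 1 <;> omega

theorem mk_sum_b_le_a :
    (PowerSeries.mk fun k => ∑ a ∈ Icc 0 k, ∑ b ∈ Ioc 0 a,
      qtMonomial (2 * k + a - 2 * b) (a + 2 * k + 2 * b)) =
    geomTail 1 (qtMonomial 1 5) * geomTail 0 (qtMonomial 3 3) *
      geomTail 0 (qtMonomial 2 2) := by
  simp only [geomTail_mul_geomTail, mk_mul_geomTail]
  ext1 k
  simp only [PowerSeries.coeff_mk, sum_mul, sum_sigma', qtMonomial_pow, qtMonomial_mul]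
  refine sum_nbij' (fun x => x) (fun x => x) ?_ ?_
    (fun _ _ => rfl) (fun _ _ => rfl) fun x hx => ?_
  all_goals simp only [mem_sigma, mem_Icc, mem_Ico, mem_Ioc, mem_range] at *
  · omega
  · omega
  · congr 1 <;> omega

theorem mk_sum_b_lt_c_le_a :
    (PowerSeries.mk fun k => ∑ a ∈ Icc 0 k, ∑ b ∈ Ioc 0 a, ∑ c ∈ Ioc b a,
      qtMonomial (2 * k + a - 2 * c) (a + b + 2 * k + c)) =
    geomTail 1 (qtMonomial 1 5) * geomTail 1 (qtMonomial 1 4) *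
      geomTail 0 (qtMonomial 3 3) * geomTail 0 (qtMonomial 2 2) := by
  simp only [geomTail_mul_geomTail, mk_mul_geomTail]
  ext1 k
  simp only [PowerSeries.coeff_mk, sum_mul, sum_sigma', qtMonomial_pow, qtMonomial_mul]
  refine sum_nbij' (fun x => ⟨x.1, x.2.2, x.2.1⟩) (fun x => ⟨x.1, x.2.2, x.2.1⟩) ?_ ?_
    (fun _ _ => rfl) (fun _ _ => rfl) fun x hx => ?_
  all_goals simp only [mem_sigma, mem_Icc, mem_Ico, mem_Ioc, mem_range] at *
  · omega
  · omega
  · congr 1 <;> omega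

theorem mk_sum_b_le_a_lt_c :
    (PowerSeries.mk fun k => ∑ a ∈ Icc 0 k, ∑ b ∈ Ioc 0 a, ∑ c ∈ Ioc a k,
      qtMonomial (2 * k - c) (a + b + 2 * k + c)) =
    geomTail 1 (qtMonomial 1 5) * geomTail 0 (qtMonomial 1 4) *
      geomTail 1 (qtMonomial 1 3) * geomTail 0 (qtMonomial 2 2) := by
  simp only [geomTail_mul_geomTail, mk_mul_geomTail]
  ext1 k
  simp only [PowerSeries.coeff_mk, sum_mul, sum_sigma', qtMonomial_pow, qtMonomial_mul]
  refine sum_nbij' (fun x => ⟨x.2.2, x.1, x.2.1⟩) (fun x => ⟨x.2.1, x.2.2, x.1⟩) ?_ ?_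
    (fun _ _ => rfl) (fun _ _ => rfl) fun x hx => ?_
  all_goals simp only [mem_sigma, mem_Icc, mem_Ico, mem_Ioc, mem_range] at *
  · omega
  · omega
  · congr 1 <;> omega

theorem mk_sum_c_le_b_le_a :
    (PowerSeries.mk fun k => ∑ a ∈ Icc 0 k, ∑ b ∈ Ioc 0 a, ∑ c ∈ Ioc 0 b,
      qtMonomial (k - c) (a + b + 3 * k + c)) =
    geomTail 1 (qtMonomial 0 6) * geomTail 0 (qtMonomial 1 5) *
      geomTail 0 (qtMonomial 1 4) * geomTail 0 (qtMonomial 1 3) := by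
  simp only [geomTail_mul_geomTail, mk_mul_geomTail]
  ext1 k
  simp only [PowerSeries.coeff_mk, sum_mul, sum_sigma', qtMonomial_pow, qtMonomial_mul]
  refine sum_nbij' (fun x => x) (fun x => x) ?_ ?_
    (fun _ _ => rfl) (fun _ _ => rfl) fun x hx => ?_
  all_goals simp only [mem_sigma, mem_Icc, mem_Ico, mem_Ioc, mem_range] at *
  · omega
  · omega
  · congr 1 <;> omega

theorem qInt_one : qInt 1 = 1 := by simp [qInt]

theorem qPairs_one : qPairs 1 = 1 := by simp [qPairs]

theorem genFun_eq_sum_geomTail :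
    genFun =
      geomTail 0 (qtMonomial 3 3) * geomTail 0 (qtMonomial 6 0) +
      PowerSeries.C (qInt 3) * (geomTail 0 (qtMonomial 3 3) * geomTail 1 (qtMonomial 3 1) *
        geomTail 0 (qtMonomial 6 0)) +
      PowerSeries.C (qInt 2) * (geomTail 1 (qtMonomial 1 4) * geomTail 0 (qtMonomial 3 3) *
        geomTail 0 (qtMonomial 3 1)) +
      PowerSeries.C (qPairs 2) * (geomTail 0 (qtMonomial 3 3) * geomTail 1 (qtMonomial 2 2) *
        geomTail 0 (qtMonomial 6 0)) +
      PowerSeries.C (qInt 2 * qInt 3) * (geomTail 0 (qtMonomial 3 3) *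
        geomTail 1 (qtMonomial 2 2) * geomTail 1 (qtMonomial 3 1) *
        geomTail 0 (qtMonomial 6 0)) +
      PowerSeries.C (qInt 2 * qInt 2) * (geomTail 1 (qtMonomial 1 4) *
        geomTail 0 (qtMonomial 3 3) * geomTail 1 (qtMonomial 2 2) *
        geomTail 0 (qtMonomial 3 1)) +
      PowerSeries.C (qInt 2) * (geomTail 0 (qtMonomial 1 4) * geomTail 1 (qtMonomial 1 3) *
        geomTail 0 (qtMonomial 2 2) * geomTail 0 (qtMonomial 3 1)) +
      geomTail 1 (qtMonomial 1 5) * geomTail 0 (qtMonomial 3 3) * geomTail 0 (qtMonomial 2 2) +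
      PowerSeries.C (qInt 2) * (geomTail 1 (qtMonomial 1 5) * geomTail 1 (qtMonomial 1 4) *
        geomTail 0 (qtMonomial 3 3) * geomTail 0 (qtMonomial 2 2)) +
      geomTail 1 (qtMonomial 1 5) * geomTail 0 (qtMonomial 1 4) * geomTail 1 (qtMonomial 1 3) *
        geomTail 0 (qtMonomial 2 2) +
      geomTail 1 (qtMonomial 0 6) * geomTail 0 (qtMonomial 1 5) * geomTail 0 (qtMonomial 1 4) *
        geomTail 0 (qtMonomial 1 3) := by
  rw [← mk_sum_a_le, ← mk_sum_a_lt_c, ← mk_sum_c_le_a, ← mk_sum_a_lt_b, ← mk_sum_a_lt_b_lt_c,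
    ← mk_sum_c_le_a_lt_b, ← mk_sum_a_lt_c_le_b, ← mk_sum_b_le_a, ← mk_sum_b_lt_c_le_a,
    ← mk_sum_b_le_a_lt_c, ← mk_sum_c_le_b_le_a]
  ext1 k
  simp only [genFun, map_add, PowerSeries.coeff_C_mul, PowerSeries.coeff_mk,
    qtCatalan_replicate_four_eq_sum_chains, qInt_one, qPairs_one, one_mul, mul_one,
    sum_add_distrib, mul_sum]
  abel

theorem sum_chain_fractions_mul {K : Type*} [Field K] {q t x : K}
    (h60 : 1 - q ^ 6 * x ≠ 0) (h33 : 1 - q ^ 3 * t ^ 3 * x ≠ 0) (h31 : 1 - q ^ 3 * t * x ≠ 0)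
    (h14 : 1 - q * t ^ 4 * x ≠ 0) (h22 : 1 - q ^ 2 * t ^ 2 * x ≠ 0) (h13 : 1 - q * t ^ 3 * x ≠ 0)
    (h15 : 1 - q * t ^ 5 * x ≠ 0) (h06 : 1 - t ^ 6 * x ≠ 0) :
    (1 / ((1 - q ^ 3 * t ^ 3 * x) * (1 - q ^ 6 * x)) +
      (1 + q + q ^ 2) * (q ^ 3 * t * x / ((1 - q ^ 3 * t ^ 3 * x) * (1 - q ^ 3 * t * x) *
        (1 - q ^ 6 * x))) +
      (1 + q) * (q * t ^ 4 * x / ((1 - q * t ^ 4 * x) * (1 - q ^ 3 * t ^ 3 * x) *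
        (1 - q ^ 3 * t * x))) +
      (1 + q + q ^ 2) * (q ^ 2 * t ^ 2 * x / ((1 - q ^ 3 * t ^ 3 * x) *
        (1 - q ^ 2 * t ^ 2 * x) * (1 - q ^ 6 * x))) +
      (1 + q) * (1 + q + q ^ 2) * ((q ^ 2 * t ^ 2 * x) * (q ^ 3 * t * x) /
        ((1 - q ^ 3 * t ^ 3 * x) * (1 - q ^ 2 * t ^ 2 * x) * (1 - q ^ 3 * t * x) *
        (1 - q ^ 6 * x))) +
      (1 + q) * (1 + q) * ((q * t ^ 4 * x) * (q ^ 2 * t ^ 2 * x) / ((1 - q * t ^ 4 * x) *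
        (1 - q ^ 3 * t ^ 3 * x) * (1 - q ^ 2 * t ^ 2 * x) * (1 - q ^ 3 * t * x))) +
      (1 + q) * (q * t ^ 3 * x / ((1 - q * t ^ 4 * x) * (1 - q * t ^ 3 * x) *
        (1 - q ^ 2 * t ^ 2 * x) * (1 - q ^ 3 * t * x))) +
      q * t ^ 5 * x / ((1 - q * t ^ 5 * x) * (1 - q ^ 3 * t ^ 3 * x) *
        (1 - q ^ 2 * t ^ 2 * x)) +
      (1 + q) * ((q * t ^ 5 * x) * (q * t ^ 4 * x) / ((1 - q * t ^ 5 * x) *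
        (1 - q * t ^ 4 * x) * (1 - q ^ 3 * t ^ 3 * x) * (1 - q ^ 2 * t ^ 2 * x))) +
      (q * t ^ 5 * x) * (q * t ^ 3 * x) / ((1 - q * t ^ 5 * x) * (1 - q * t ^ 4 * x) *
        (1 - q * t ^ 3 * x) * (1 - q ^ 2 * t ^ 2 * x)) +
      t ^ 6 * x / ((1 - t ^ 6 * x) * (1 - q * t ^ 5 * x) * (1 - q * t ^ 4 * x) *
        (1 - q * t ^ 3 * x))) *
    ((1 - q ^ 3 * t * x) * (1 - q ^ 2 * t ^ 2 * x) * (1 - q * t ^ 3 * x) * (1 - q ^ 6 * x) *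
      (1 - t ^ 6 * x)) =
    1 + (q ^ 5 * t + q ^ 4 * t ^ 2 + q ^ 3 * t ^ 3 + q ^ 2 * t ^ 4 + q * t ^ 5
      + q ^ 4 * t + q ^ 3 * t ^ 2 + q ^ 2 * t ^ 3 + q * t ^ 4) * x
    + (q ^ 6 * t ^ 5 + q ^ 5 * t ^ 6 - q ^ 7 * t ^ 3 - q ^ 6 * t ^ 4 - q ^ 5 * t ^ 5
      - q ^ 4 * t ^ 6 - q ^ 3 * t ^ 7 - q ^ 5 * t ^ 4 - q ^ 4 * t ^ 5) * x ^ 2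
    - (q ^ 8 * t ^ 8 + q ^ 9 * t ^ 6 + q ^ 8 * t ^ 7 + q ^ 7 * t ^ 8 + q ^ 6 * t ^ 9) * x ^ 3 := by
  field_simp
  ring

theorem genFun_mul_denominator :
    genFun * (denominator : PowerSeries (MvPolynomial (Fin 2) ℤ)) =
      (numerator : PowerSeries (MvPolynomial (Fin 2) ℤ)) := by
  set ψ := algebraMap (PowerSeries (MvPolynomial (Fin 2) ℤ))
    (FractionRing (PowerSeries (MvPolynomial (Fin 2) ℤ)))
  apply IsFractionRing.injective (PowerSeries (MvPolynomial (Fin 2) ℤ))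
    (FractionRing (PowerSeries (MvPolynomial (Fin 2) ℤ)))
  have nonzero (i j : ℕ) : 1 - ψ (PowerSeries.C q) ^ i * ψ (PowerSeries.C t) ^ j *
      ψ PowerSeries.X ≠ 0 := by
    simpa only [qtMonomial, map_mul, map_pow] using one_sub_map_ne_zero ψ (qtMonomial i j)
  have identity := sum_chain_fractions_mul (by simpa using nonzero 6 0) (nonzero 3 3)
    (by simpa using nonzero 3 1) (by simpa using nonzero 1 4) (nonzero 2 2)
    (by simpa using nonzero 1 3) (by simpa using nonzero 1 5) (by simpa using nonzero 0 6)
  have qInt_two : qInt 2 = 1 + q := by simp [qInt, sum_range_succ]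
  have qInt_three : qInt 3 = 1 + q + q ^ 2 := by simp [qInt, sum_range_succ]
  have qPairs_two : qPairs 2 = 1 + q + q ^ 2 := by simp [qPairs, sum_range_succ, ← add_assoc]
  rw [genFun_eq_sum_geomTail, qInt_two, qInt_three, qPairs_two]
  simpa only [map_geomTail, denominator, factor, numerator, qtMonomial, Polynomial.coe_add,
    Polynomial.coe_sub, Polynomial.coe_mul, Polynomial.coe_C, Polynomial.coe_X, Polynomial.coe_pow,
    Polynomial.coe_one, map_mul, map_add, map_sub, map_one, map_pow, pow_zero, pow_one, one_mul,
    mul_one, div_mul_div_comm] using identity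

/-! ### Symmetry -/

theorem map_eq_self_of_mul_eq_coe {R : Type*} [CommRing R] [IsDomain R] {φ : R →+* R}
    {f : PowerSeries R} {P Q : Polynomial R} (hP : P ≠ 0)
    (hf : f * (P : PowerSeries R) = (Q : PowerSeries R)) (hφP : P.map φ = P) (hφQ : Q.map φ = Q) :
    f.map φ = f := by
  refine mul_right_cancel₀ (b := (P : PowerSeries R)) (by simpa using hP) ?_
  calc f.map φ * P = (f * P).map φ := by rw [map_mul, ← Polynomial.polynomial_map_coe, hφP]
    _ = f * P := by rw [hf, ← Polynomial.polynomial_map_coe, hφQ]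

theorem denominator_ne_zero : denominator ≠ 0 := by
  intro h
  simpa [denominator, factor] using congrArg (Polynomial.coeff · 0) h

theorem map_swap_denominator :
    denominator.map (MvPolynomial.rename (R := ℤ) (Equiv.swap (0 : Fin 2) 1)).toRingHom =
      denominator := by
  have map_factor (i j : ℕ) : (factor i j).map
      (MvPolynomial.rename (R := ℤ) (Equiv.swap (0 : Fin 2) 1)).toRingHom = factor j i := by
    simp [factor, q, t, mul_comm]
  simp only [denominator, Polynomial.map_mul, map_factor]
  ring

theorem map_swap_numerator :
    numerator.map (MvPolynomial.rename (R := ℤ) (Equiv.swap (0 : Fin 2) 1)).toRingHom =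
      numerator := by
  simp only [numerator, q, t, Polynomial.map_add, Polynomial.map_sub, Polynomial.map_mul,
    Polynomial.map_pow, Polynomial.map_one, Polynomial.map_X, Polynomial.map_C,
    AlgHom.toRingHom_eq_coe, RingHom.coe_coe, map_add, map_sub, map_mul, map_pow,
    MvPolynomial.rename_X, Equiv.swap_apply_left, Equiv.swap_apply_right]
  ring

theorem map_swap_genFun :
    genFun.map (MvPolynomial.rename (R := ℤ) (Equiv.swap (0 : Fin 2) 1)).toRingHom = genFun :=
  map_eq_self_of_mul_eq_coe denominator_ne_zero genFun_mul_denominator map_swap_denominator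
    map_swap_numerator

end QTCatalan

theorem mainTheorem5 :
    (∀ k : ℕ, QTCatalan.swapQT (QTCatalan.qtCatalan (List.replicate 4 k)) =
      QTCatalan.qtCatalan (List.replicate 4 k)) ∧
    QTCatalan.genFun * (QTCatalan.denominator : PowerSeries (MvPolynomial (Fin 2) ℤ)) =
      (QTCatalan.numerator : PowerSeries (MvPolynomial (Fin 2) ℤ)) := by
  refine ⟨fun k => ?_, QTCatalan.genFun_mul_denominator⟩
  have h := congrArg (PowerSeries.coeff k) QTCatalan.map_swap_genFun
  rw [PowerSeries.coeff_map, QTCatalan.genFun, PowerSeries.coeff_mk] at h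
  exact h
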